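/- Let $0<p<1$. Consider the following random process of finite simple graphs $(G_m)_{m\ge 0}$. The graph $G_0$ is a single isolated vertex. Given $G_0,\dots,G_m$, the graph $G_{m+1}$ is obtained from $G_m$ by one of the following two steps: with probability $p$, a vertex $v$ of $G_m$ is chosen uniformly at random, and a new vertex $w$ is added and joined by edges to $v$ and to all neighbours of $v$ (duplication); with probability $1-p$, a vertex of $G_m$ is chosen uniformly at random and all edges incident to it are deleted, the vertex itself being kept (deletion). Let $N_m$ be the number of vertices of $G_m$ and, for $k\ge 1$, let $D_{m,k}$ be the number of vertices of degree $k-1$ in $G_m$ (since $G_m$ is almost surely a disjoint union of cliques, this is the number of vertices that lie in cliques of size exactly $k$). Then there is a unique bounded sequence $(d_k)_{k\ge 0}$ of positive real numbers such that $$d_0=\frac{1-p}{p},\qquad d_k=\frac{p\,k\,d_{k-1}+(1-p)\,k\,d_{k+1}}{k+p}\quad\text{for all } k\ge 1,$$ and for every $k\ge 1$ $$\lim_{m\to\infty}\frac{D_{m,k}}{N_m}=d_k\qquad\text{almost surely.}$$ -/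

import Mathlib

open MeasureTheory ProbabilityTheory Filter Topology

/-- A finite nonempty simple graph on the labelled vertex set `{0, …, last}`, so that it has
`last + 1` vertices. These are the states of the random graph process. -/
structure LabelledGraph where
  /-- The label of the most recently added vertex. -/
  last : ℕ
  /-- The edges. -/
  graph : SimpleGraph (Fin (last + 1))

namespace LabelledGraph

/-- Every set of finite graphs is an event. -/
instance : MeasurableSpace LabelledGraph := ⊤

/-- A single isolated vertex. -/
def single : LabelledGraph := ⟨0, ⊥⟩

/-- The vertices of `G`. -/
abbrev Vert (G : LabelledGraph) : Type := Fin (G.last + 1)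

/-- The number of vertices. -/
def numVerts (G : LabelledGraph) : ℕ := Fintype.card G.Vert

/-- Duplication of `v`: the old vertices `u` keep their edges (they are embedded as
`u.castSucc`), and a new vertex is joined to `v` and to all neighbours of `v`. -/
def duplicate (G : LabelledGraph) (v : G.Vert) : LabelledGraph where
  last := G.last + 1
  graph := G.graph.map Fin.castSuccEmb ⊔
    SimpleGraph.fromRel fun x y =>
      x = Fin.last (G.last + 1) ∧ ∃ u : G.Vert, y = u.castSucc ∧ (u = v ∨ G.graph.Adj v u)

/-- Deletion at `v`: all edges incident to `v` are removed, `v` itself stays. -/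
def isolate (G : LabelledGraph) (v : G.Vert) : LabelledGraph where
  last := G.last
  graph := G.graph.deleteIncidenceSet v

open Classical in
/-- The probability that one step leads from `G` to `H`: the step is a duplication with
probability `p` and a deletion with probability `1 - p`, at a uniformly chosen vertex of `G`. -/
noncomputable def stepProb (p : ℝ) (G H : LabelledGraph) : ℝ :=
  p * ∑ v : G.Vert, (1 / (G.numVerts : ℝ)) * (if G.duplicate v = H then 1 else 0) +
    (1 - p) * ∑ v : G.Vert, (1 / (G.numVerts : ℝ)) * (if G.isolate v = H then 1 else 0)

open Classical in
/-- The number of vertices of degree `k - 1`, for `k ≥ 1` (in a disjoint union of cliques: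
the number of vertices that lie in cliques of size `k`). -/
noncomputable def numInCliques (G : LabelledGraph) (k : ℕ) : ℕ :=
  (Finset.univ.filter fun v : G.Vert => G.graph.degree v + 1 = k).card

end LabelledGraph

/-- `G` is a duplication-deletion random graph process with parameter `p`: it is adapted to the
filtration `ℱ`, starts from a single isolated vertex, and given the history up to time `m` the
graph at time `m + 1` is obtained from `G m` by one random step. -/
structure IsDuplicationDeletionProcess {Ω : Type*} {mΩ : MeasurableSpace Ω} (p : ℝ)
    (μ : Measure Ω) (ℱ : Filtration ℕ mΩ) (G : ℕ → Ω → LabelledGraph) : Prop where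
  adapted : ∀ m, Measurable[ℱ m] (G m)
  start : ∀ᵐ ω ∂μ, G 0 ω = LabelledGraph.single
  step : ∀ (m : ℕ) (H : LabelledGraph),
    μ[(G (m + 1) ⁻¹' {H}).indicator (fun _ => (1 : ℝ)) | ℱ m] =ᵐ[μ]
      fun ω => LabelledGraph.stepProb p (G m ω) H

/-- `d` is a bounded positive solution of the recursion with parameter `p`. -/
structure IsBoundedPositiveSolution (p : ℝ) (d : ℕ → ℝ) : Prop where
  bounded : ∃ B : ℝ, ∀ k, |d k| ≤ B
  pos : ∀ k, 0 < d k
  zero : d 0 = (1 - p) / p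
  rec_eq : ∀ k : ℕ, 1 ≤ k →
    d k = (p * k * d (k - 1) + (1 - p) * k * d (k + 1)) / (k + p)

/-!
The proof is a stochastic approximation argument whose infinite, non-triangular limiting system is
controlled by a maximum principle.

Let `x k = D k / N` be the proportion of vertices of degree `k - 1`. Double counting pairs of
vertices (`sum_numInCliques_duplicate`, `sum_numInCliques_isolate`) shows that, with the convention
`x 0 = (1 - p) / p`, one step changes `D k` on average by
`k * (p * x (k - 1) + (1 - p) * x (k + 1) - x k)`, while `N` grows on average by `p`. Hence, if `d`
solves the recursion and `y k = x k - d k`, the quantity `D k - d k * N = y k * N` has the mean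
increment `k * (p * y (k - 1) + (1 - p) * y (k + 1) - y k)` (`stepMean_excess`). Since the graph is
almost surely a disjoint union of cliques, these quantities have bounded increments, and the
strong law for bounded martingale differences (`ae_tendsto_average_martingaleDifference`) makes the
accumulated noise `o(m)`.

From then on everything is deterministic. By `eventually_abs_div_le` the numbers
`e k = limsup |y k|` satisfy `e k ≤ k / (k + p) * (p * e (k - 1) + (1 - p) * e (k + 1))`, and
`e 0 = 0`. Such a bounded subsolution vanishes (`eq_zero_of_subsolution`): the sequence
`1 / p + log (k + 1)` is a supersolution tending to infinity, so the difference of the subsolution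
and a small multiple of it would attain a positive maximum if it were positive anywhere, which the
recursion rules out. The same principle gives
uniqueness of `d`; existence follows by monotone iteration from a constant supersolution.
-/

/-! ### The recursion -/

/-- Maximum principle: a bounded nonnegative subsolution of the recursion with boundary value `0`
vanishes. It holds because there is a positive supersolution tending to infinity. -/
lemma eq_zero_of_subsolution {p : ℝ} (hp0 : 0 < p) (hp1 : p < 1) {w : ℕ → ℝ} {B : ℝ}
    (hB : ∀ k, w k ≤ B) (h_nonneg : ∀ k, 0 ≤ w k) (h0 : w 0 = 0)
    (hw : ∀ k : ℕ, 1 ≤ k → (k + p) * w k ≤ k * (p * w (k - 1) + (1 - p) * w (k + 1))) (k : ℕ) :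
    w k = 0 := by
  -- The supersolution `h` is positive and increasing, tends to infinity, and satisfies
  -- `k * (h (k + 1) - h k) ≤ 1 ≤ p * h k`.
  set h : ℕ → ℝ := fun k => 1 / p + Real.log (k + 1) with hdef
  have hp : ∀ k, 1 ≤ p * h k := fun k => by
    have : 0 ≤ Real.log ((k : ℝ) + 1) := Real.log_nonneg (by linarith [k.cast_nonneg (α := ℝ)])
    have h2 : p * h k = 1 + p * Real.log (k + 1) := by simp only [hdef]; field_simp
    nlinarith
  have hpos : ∀ k, 0 < h k := fun k => by
    have := hp k
    by_contra hc
    nlinarith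
  have hmono : ∀ k, h k ≤ h (k + 1) := fun k => by
    simp only [hdef]
    gcongr
    linarith
  have hinc : ∀ k : ℕ, k * (h (k + 1) - h k) ≤ 1 := fun k => by
    have hk : (0 : ℝ) < (k : ℝ) + 1 := by positivity
    have h1 : Real.log (((k : ℝ) + 1 + 1) / (k + 1)) ≤ ((k : ℝ) + 1 + 1) / (k + 1) - 1 :=
      Real.log_le_sub_one_of_pos (by positivity)
    rw [Real.log_div (by positivity) (by positivity)] at h1
    have h2 : ((k : ℝ) + 1 + 1) / (k + 1) - 1 = 1 / (k + 1) := by field_simp; ring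
    have h3 : h (k + 1) - h k ≤ 1 / (k + 1) := by
      simp only [hdef]; push_cast; linarith
    calc (k : ℝ) * (h (k + 1) - h k) ≤ k * (1 / (k + 1)) := by gcongr
      _ ≤ 1 := by rw [mul_one_div, div_le_one hk]; linarith
  have hsup : ∀ k : ℕ, 1 ≤ k → k * (p * h (k - 1) + (1 - p) * h (k + 1)) ≤ (k + p) * h k := by
    intro k hk
    obtain ⟨j, rfl⟩ : ∃ j, k = j + 1 := ⟨k - 1, by omega⟩
    rw [Nat.add_sub_cancel]
    have hj : (0 : ℝ) ≤ ((j + 1 : ℕ) : ℝ) := Nat.cast_nonneg _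
    have h1 := hinc (j + 1)
    have h2 := hp (j + 1)
    have h3 : 0 ≤ ((j + 1 : ℕ) : ℝ) * (p * (h (j + 1) - h j)) :=
      mul_nonneg hj (mul_nonneg hp0.le (by linarith [hmono j]))
    have h4 : 0 ≤ p * (((j + 1 : ℕ) : ℝ) * (h (j + 1 + 1) - h (j + 1))) :=
      mul_nonneg hp0.le (mul_nonneg hj (by linarith [hmono (j + 1)]))
    linarith
  have hlim : Tendsto h atTop atTop :=
    tendsto_atTop_add_const_left _ _
      (Real.tendsto_log_atTop.comp (tendsto_atTop_add_const_right _ _ tendsto_natCast_atTop_atTop))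
  have key : ∀ ε : ℝ, 0 < ε → ∀ k, w k ≤ ε * h k := by
    intro ε hε
    by_contra! hcon
    obtain ⟨i, hi⟩ := hcon
    -- Beyond some index `w - ε h` is negative, so its maximum is attained.
    obtain ⟨K, hK⟩ := (hlim.eventually_ge_atTop (B / ε)).exists_forall_of_atTop
    obtain ⟨j, hj, hmax⟩ := Finset.exists_max_image (Finset.range (max K (i + 1)))
      (fun k => w k - ε * h k) ⟨i, by simp⟩
    have hij := hmax i (by simp)
    have hall : ∀ k, w k - ε * h k ≤ w j - ε * h j := by
      intro k
      by_cases hk : k < max K (i + 1)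
      · exact hmax k (Finset.mem_range.2 hk)
      · have h1 := hK k (by omega)
        rw [div_le_iff₀ hε] at h1
        linarith [hB k]
    have hj1 : 1 ≤ j := by
      rcases Nat.eq_zero_or_pos j with rfl | hj
      · have := mul_pos hε (hpos 0)
        simp only [h0] at hij
        linarith
      · exact hj
    have e1 := hw j hj1
    have e2 := mul_le_mul_of_nonneg_left (hsup j hj1) hε.le
    have e3 := mul_le_mul_of_nonneg_left (hall (j - 1)) hp0.le
    have e4 := mul_le_mul_of_nonneg_left (hall (j + 1)) (sub_nonneg.2 hp1.le)
    have e5 := mul_le_mul_of_nonneg_left (add_le_add e3 e4) (Nat.cast_nonneg (α := ℝ) j)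
    have e6 : 0 < p * (w j - ε * h j) := mul_pos hp0 (by linarith)
    linarith
  refine le_antisymm (le_of_forall_pos_le_add fun ε hε => ?_) (h_nonneg k)
  have := key (ε / h k) (div_pos hε (hpos k)) k
  rw [div_mul_cancel₀ _ (hpos k).ne'] at this
  linarith

lemma IsBoundedPositiveSolution.mul_eq {p : ℝ} (hp0 : 0 < p) {d : ℕ → ℝ}
    (hd : IsBoundedPositiveSolution p d) {k : ℕ} (hk : 1 ≤ k) :
    (k + p) * d k = k * (p * d (k - 1) + (1 - p) * d (k + 1)) := by
  have : (k : ℝ) + p ≠ 0 := by positivity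
  have h := hd.rec_eq k hk
  rw [eq_div_iff this] at h
  linarith

lemma IsBoundedPositiveSolution.unique {p : ℝ} (hp0 : 0 < p) (hp1 : p < 1) {d e : ℕ → ℝ}
    (hd : IsBoundedPositiveSolution p d) (he : IsBoundedPositiveSolution p e) : d = e := by
  obtain ⟨B, hB⟩ := hd.bounded
  obtain ⟨C, hC⟩ := he.bounded
  have key := eq_zero_of_subsolution hp0 hp1 (w := fun k => |d k - e k|) (B := B + C)
    (fun k => (abs_sub _ _).trans (add_le_add (hB k) (hC k))) (fun k => abs_nonneg _)
    (by simp [hd.zero, he.zero]) (by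
      intro k hk
      have hk0 : (0 : ℝ) < k + p := by positivity
      have h1 : (k + p) * (d k - e k) = k * (p * (d (k - 1) - e (k - 1)) +
          (1 - p) * (d (k + 1) - e (k + 1))) := by
        linarith [hd.mul_eq hp0 hk, he.mul_eq hp0 hk]
      rw [← abs_of_pos hk0, ← abs_mul, h1, abs_mul, Nat.abs_cast]
      gcongr
      refine (abs_add_le _ _).trans_eq ?_
      rw [abs_mul, abs_mul, abs_of_pos hp0, abs_of_pos (sub_pos.2 hp1)])
  funext k
  exact sub_eq_zero.1 (abs_eq_zero.1 (key k))

/-- One step of the monotone iteration: the right-hand side of the recursion, with the prescribed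
value at `0`. -/
noncomputable def recursionStep (p : ℝ) (d : ℕ → ℝ) (k : ℕ) : ℝ :=
  if k = 0 then (1 - p) / p else (p * k * d (k - 1) + (1 - p) * k * d (k + 1)) / (k + p)

lemma recursionStep_mono {p : ℝ} (hp0 : 0 < p) (hp1 : p < 1) {d e : ℕ → ℝ} (h : ∀ k, d k ≤ e k)
    (k : ℕ) : recursionStep p d k ≤ recursionStep p e k := by
  unfold recursionStep
  split_ifs
  · rfl
  · have := sub_pos.2 hp1
    gcongr <;> exact h _

/-- Iterating the recursion from the constant sequence `d 0`, a supersolution, gives a pointwise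
decreasing sequence, whose limit is the solution. -/
lemma exists_isBoundedPositiveSolution {p : ℝ} (hp0 : 0 < p) (hp1 : p < 1) :
    ∃ d, IsBoundedPositiveSolution p d := by
  have hp1' := sub_pos.2 hp1
  have hc : 0 < (1 - p) / p := div_pos hp1' hp0
  set c := (1 - p) / p with hcdef
  set D : ℕ → ℕ → ℝ := fun n => (recursionStep p)^[n] fun _ => c with hD
  have hsucc : ∀ n, D (n + 1) = recursionStep p (D n) := fun n =>
    Function.iterate_succ_apply' _ _ _
  have hstep : ∀ n k, D (n + 1) k ≤ D n k := by
    intro n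
    induction n with
    | zero =>
      intro k
      rw [hsucc]
      change recursionStep p (fun _ => c) k ≤ c
      unfold recursionStep
      split_ifs with hk
      · rfl
      · rw [div_le_iff₀ (by positivity)]
        nlinarith
    | succ n ih =>
      intro k
      rw [hsucc (n + 1), hsucc n]
      exact hsucc n ▸ recursionStep_mono hp0 hp1 ih k
  have hnn : ∀ n k, 0 ≤ D n k := by
    intro n
    induction n with
    | zero => exact fun k => hc.le
    | succ n ih =>
      intro k
      rw [hsucc]
      unfold recursionStep
      split_ifs
      · exact hc.le
      · have := ih (k - 1)
        have := ih (k + 1)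
        positivity
  have hanti : ∀ k, Antitone fun n => D n k := fun k => antitone_nat_of_succ_le fun n => hstep n k
  have hlim : ∀ k, Tendsto (fun n => D n k) atTop (𝓝 (⨅ n, D n k)) := fun k =>
    tendsto_atTop_ciInf (hanti k) ⟨0, by rintro _ ⟨n, rfl⟩; exact hnn n k⟩
  set d : ℕ → ℝ := fun k => ⨅ n, D n k with hd
  have hfix : ∀ k, d k = recursionStep p d k := by
    intro k
    refine tendsto_nhds_unique ((tendsto_add_atTop_iff_nat 1).2 (hlim k)) ?_
    simp only [hsucc]
    unfold recursionStep
    split_ifs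
    · exact tendsto_const_nhds
    · exact (((hlim _).const_mul _).add ((hlim _).const_mul _)).div_const _
  have hd0 : ∀ k, 0 ≤ d k := fun k => ge_of_tendsto' (hlim k) fun n => hnn n k
  have hdc : ∀ k, d k ≤ c := fun k => le_of_tendsto' (hlim k) fun n => hanti k (Nat.zero_le n)
  refine ⟨d, ⟨c, fun k => by rw [abs_of_nonneg (hd0 k)]; exact hdc k⟩, ?_, ?_, ?_⟩
  · intro k
    induction k with
    | zero => rw [hfix]; simpa [recursionStep] using hc
    | succ k ih =>
      rw [hfix, recursionStep, if_neg (by omega), Nat.add_sub_cancel]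
      have := hd0 (k + 1 + 1)
      positivity
  · rw [hfix]; simp [recursionStep]
  · intro k hk
    rw [hfix k, recursionStep, if_neg (by omega)]

/-! ### Deterministic stochastic approximation -/

/-- A linear recursion with coefficients `1 - a / m`: the line `c * m` with `c * (1 + a) = B`
solves it for the constant forcing term `B`, and the excess over this line does not grow. -/
lemma eventually_abs_le_of_recursion {F g : ℕ → ℝ} {a B : ℝ} (ha : 0 ≤ a) (hB : 0 ≤ B)
    (hF : ∀ m : ℕ, 1 ≤ m → F (m + 1) = F m * (1 - a / m) + g m)
    (hg : ∀ᶠ m in atTop, |g m| ≤ B) {ε : ℝ} (hε : 0 < ε) :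
    ∀ᶠ m : ℕ in atTop, |F m| ≤ (B / (1 + a) + ε) * m := by
  set c := B / (1 + a) with hc
  have hca : c * (1 + a) = B := div_mul_cancel₀ _ (by positivity)
  obtain ⟨M, hM⟩ := (hg.and ((eventually_ge_atTop 1).and
    (tendsto_natCast_atTop_atTop.eventually_ge_atTop a))).exists_forall_of_atTop
  have hbound : ∀ m, M ≤ m → |F m| ≤ c * m + |F M| := by
    intro m hm
    induction m, hm using Nat.le_induction with
    | base =>
      have : 0 ≤ c * M := by positivity
      linarith
    | succ m hm ih =>
      obtain ⟨h1, h2, h3⟩ := hM m hm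
      have hm0 : (0 : ℝ) < m := by exact_mod_cast h2
      have h4 : 0 ≤ 1 - a / m := by rw [sub_nonneg, div_le_one hm0]; exact h3
      have h5 : 0 ≤ a / m := by positivity
      have h6 : c * m * (a / m) = c * a := by field_simp
      calc |F (m + 1)| ≤ |F m| * (1 - a / m) + B := by
            rw [hF m h2]
            refine (abs_add_le _ _).trans (add_le_add ?_ h1)
            rw [abs_mul, abs_of_nonneg h4]
        _ ≤ (c * m + |F M|) * (1 - a / m) + B := by gcongr
        _ ≤ c * ((m + 1 : ℕ) : ℝ) + |F M| := by
            push_cast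
            nlinarith [mul_nonneg (abs_nonneg (F M)) h5]
  filter_upwards [eventually_ge_atTop M,
    tendsto_natCast_atTop_atTop.eventually_ge_atTop (|F M| / ε)] with m hm hm2
  rw [div_le_iff₀ hε] at hm2
  linarith [hbound m hm]

/-- A bound for the forcing term of a stochastic approximation passes to the solution, improved by
the factor `k / (k + p)`. Subtracting the accumulated noise and replacing `N m` by `p * m` turns the
recursion into the one of `eventually_abs_le_of_recursion` with `a = k / p`. -/
lemma eventually_abs_div_le {p κ B M : ℝ} (hp0 : 0 < p) (hκ : 0 ≤ κ) (hB : 0 ≤ B)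
    {E N b ζ : ℕ → ℝ} (hN : ∀ m, 0 < N m) (hNlim : Tendsto (fun m : ℕ => N m / m) atTop (𝓝 p))
    (hE : ∀ m, E (m + 1) = E m + κ * (b m - E m / N m) + ζ m) (hEb : ∀ m, |E m / N m| ≤ M)
    (hζ : Tendsto (fun m : ℕ => (∑ i ∈ Finset.range m, ζ i) / m) atTop (𝓝 0))
    (hb : ∀ ε, 0 < ε → ∀ᶠ m in atTop, |b m| ≤ B + ε) {η : ℝ} (hη : 0 < η) :
    ∀ᶠ m in atTop, |E m / N m| ≤ κ * B / (κ + p) + η := by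
  set Z : ℕ → ℝ := fun m => ∑ i ∈ Finset.range m, ζ i with hZ
  set r : ℕ → ℝ := fun m => κ * (E m / N m * (N m / m / p - 1)) - κ / p * (Z m / m) with hr
  have hr0 : Tendsto r atTop (𝓝 0) := by
    have h1 : Tendsto (fun m : ℕ => N m / m / p - 1) atTop (𝓝 0) := by
      simpa [div_self hp0.ne'] using (hNlim.div_const p).sub_const 1
    have h2 : Tendsto (fun m : ℕ => E m / N m * (N m / m / p - 1)) atTop (𝓝 0) := by
      refine squeeze_zero_norm (fun m => ?_) (by simpa using h1.abs.const_mul M)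
      rw [norm_mul]
      exact mul_le_mul_of_nonneg_right (hEb m) (norm_nonneg _)
    simpa using (h2.const_mul κ).sub (hζ.const_mul (κ / p))
  set δ := p * η / 4 with hδ
  have hδ0 : 0 < δ := by positivity
  have hg : ∀ᶠ m in atTop, |κ * b m + r m| ≤ κ * B + δ := by
    have hδ' : 0 < δ / (2 * (κ + 1)) := by positivity
    filter_upwards [hb _ hδ',
      hr0.abs.eventually_le_const (u := δ / 2) (by simpa using by positivity)] with m h1 h2
    have h3 : κ * |b m| ≤ κ * B + δ / 2 := by
      calc κ * |b m| ≤ κ * (B + δ / (2 * (κ + 1))) := by gcongr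
        _ = κ * B + κ / (κ + 1) * (δ / 2) := by field_simp
        _ ≤ κ * B + 1 * (δ / 2) := by
            gcongr
            rw [div_le_one (by positivity)]
            linarith
        _ = κ * B + δ / 2 := by ring
    calc |κ * b m + r m| ≤ κ * |b m| + |r m| := by
          rw [← abs_of_nonneg hκ, ← abs_mul, abs_of_nonneg hκ]; exact abs_add_le _ _
      _ ≤ κ * B + δ := by linarith
  have hF := eventually_abs_le_of_recursion (F := fun m => E m - Z m)
    (g := fun m => κ * b m + r m) (a := κ / p) (by positivity) (by positivity) (by
      intro m hm
      have hm0 : (m : ℝ) ≠ 0 := by positivity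
      have hNm := (hN m).ne'
      simp only [hr, hZ, hE m, Finset.sum_range_succ]
      field_simp
      ring) hg hδ0
  have hlim : Tendsto (fun m : ℕ => ((κ * B + δ) / (1 + κ / p) + δ + |Z m / m|) / (N m / m)) atTop
      (𝓝 (((κ * B + δ) / (1 + κ / p) + δ + |0|) / p)) :=
    (hζ.abs.const_add _).div hNlim hp0.ne'
  have hlt : ((κ * B + δ) / (1 + κ / p) + δ + |0|) / p < κ * B / (κ + p) + η := by
    have e1 : ((κ * B + δ) / (1 + κ / p) + δ + |0|) / p =
        κ * B / (κ + p) + δ / (κ + p) + δ / p := by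
      rw [abs_zero]; field_simp; ring
    have e2 : δ / (κ + p) ≤ δ / p := by gcongr; linarith
    have e3 : δ / p = η / 4 := by rw [hδ]; field_simp
    rw [e1]
    linarith
  filter_upwards [hF, hlim.eventually_lt_const hlt, eventually_ge_atTop 1] with m h1 h2 h3
  refine le_trans ?_ h2.le
  have hm0 : (0 : ℝ) < m := by exact_mod_cast h3
  have h4 : |E m| ≤ |E m - Z m| + |Z m| := by
    simpa using abs_add_le (E m - Z m) (Z m)
  rw [abs_div, abs_of_pos (hN m), abs_div, abs_of_pos hm0, div_le_div_iff₀ (hN m)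
    (div_pos (hN m) hm0)]
  calc |E m| * (N m / m) ≤ (((κ * B + δ) / (1 + κ / p) + δ) * m + |Z m|) * (N m / m) := by
        have := hN m
        gcongr
        linarith
    _ = _ := by field_simp

/-- The limits superior of the deviations form a nonnegative bounded subsolution, so they vanish by
the maximum principle. -/
lemma tendsto_zero_of_deviation_recursion {p B : ℝ} (hp0 : 0 < p) (hp1 : p < 1)
    {y ζ : ℕ → ℕ → ℝ} {N : ℕ → ℝ} (hN : ∀ m, 0 < N m)
    (hNlim : Tendsto (fun m : ℕ => N m / m) atTop (𝓝 p)) (hy0 : ∀ m, y 0 m = 0)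
    (hM : ∀ k m, |y k m| ≤ B)
    (hy : ∀ k m : ℕ, 1 ≤ k → y k (m + 1) * N (m + 1) = y k m * N m +
      k * (p * y (k - 1) m + (1 - p) * y (k + 1) m - y k m) + ζ k m)
    (hζ : ∀ k, 1 ≤ k → Tendsto (fun m : ℕ => (∑ i ∈ Finset.range m, ζ k i) / m) atTop (𝓝 0))
    (k : ℕ) : Tendsto (y k) atTop (𝓝 0) := by
  have hq := sub_pos.2 hp1
  have hbdd : ∀ k, IsBoundedUnder (· ≤ ·) atTop fun m => |y k m| := fun k =>
    isBoundedUnder_of ⟨B, hM k⟩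
  have hcob : ∀ k, IsCoboundedUnder (· ≤ ·) atTop fun m => |y k m| := fun k =>
    (isBoundedUnder_of ⟨0, fun m => abs_nonneg _⟩ :
      IsBoundedUnder (· ≥ ·) atTop _).isCoboundedUnder_le
  set e : ℕ → ℝ := fun k => limsup (fun m => |y k m|) atTop with he
  have hev : ∀ k ε, 0 < ε → ∀ᶠ m in atTop, |y k m| ≤ e k + ε := fun k ε hε =>
    (eventually_lt_of_limsup_lt (lt_add_of_pos_right _ hε) (hbdd k)).mono fun _ h => h.le
  have hle : ∀ k c, (∀ ε, 0 < ε → ∀ᶠ m in atTop, |y k m| ≤ c + ε) → e k ≤ c := fun k c h =>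
    le_of_forall_pos_le_add fun ε hε => limsup_le_of_le (hcob k) (h ε hε)
  have hnn : ∀ k, 0 ≤ e k := fun k => le_of_forall_pos_le_add fun ε hε => by
    obtain ⟨m, hm⟩ := (hev k ε hε).exists
    exact (abs_nonneg _).trans hm
  have hzero : ∀ k, e k = 0 := by
    refine eq_zero_of_subsolution hp0 hp1 (B := B)
      (fun k => hle k B fun ε hε => Eventually.of_forall fun m => (hM k m).trans (by linarith))
      hnn (le_antisymm (hle 0 0 fun ε hε => Eventually.of_forall fun m => by
        rw [hy0, abs_zero]; linarith) (hnn 0)) ?_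
    intro k hk
    have hkp : (0 : ℝ) < k + p := by positivity
    rw [← le_div_iff₀' hkp]
    refine hle k _ fun ε hε => ?_
    have hdiv : ∀ m, y k m * N m / N m = y k m := fun m => mul_div_cancel_right₀ _ (hN m).ne'
    have := eventually_abs_div_le (E := fun m => y k m * N m) (κ := k)
      (b := fun m => p * y (k - 1) m + (1 - p) * y (k + 1) m)
      (B := p * e (k - 1) + (1 - p) * e (k + 1)) (ζ := ζ k) (M := B) hp0 (Nat.cast_nonneg k)
      (add_nonneg (mul_nonneg hp0.le (hnn _)) (mul_nonneg hq.le (hnn _))) hN hNlim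
      (fun m => by rw [hdiv, hy k m hk]) (fun m => by rw [hdiv]; exact hM k m) (hζ k hk) (by
        intro ε hε
        filter_upwards [hev (k - 1) ε hε, hev (k + 1) ε hε] with m h1 h2
        calc |p * y (k - 1) m + (1 - p) * y (k + 1) m|
            ≤ p * |y (k - 1) m| + (1 - p) * |y (k + 1) m| := by
              refine (abs_add_le _ _).trans_eq ?_
              rw [abs_mul, abs_mul, abs_of_pos hp0, abs_of_pos hq]
          _ ≤ p * (e (k - 1) + ε) + (1 - p) * (e (k + 1) + ε) := by gcongr
          _ = p * e (k - 1) + (1 - p) * e (k + 1) + ε := by ring) hε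
    simpa only [hdiv] using this
  rw [tendsto_zero_iff_abs_tendsto_zero]
  refine tendsto_order.2 ⟨fun a ha => Eventually.of_forall fun m => ha.trans_le (abs_nonneg _),
    fun a ha => ?_⟩
  filter_upwards [hev k (a / 2) (half_pos ha)] with m hm
  rw [hzero k] at hm
  exact hm.trans_lt (by linarith)

/-! ### Cliques under duplication and deletion -/

namespace LabelledGraph

lemma numVerts_eq (G : LabelledGraph) : G.numVerts = G.last + 1 := by
  simp [numVerts]

lemma numVerts_pos (G : LabelledGraph) : (0 : ℝ) < G.numVerts := by
  rw [numVerts_eq]; positivity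

/-- The graph is a disjoint union of cliques: adjacency is transitive on distinct vertices. -/
def IsCliqueUnion (G : LabelledGraph) : Prop :=
  ∀ ⦃x y z : G.Vert⦄, G.graph.Adj x y → G.graph.Adj y z → x ≠ z → G.graph.Adj x z

lemma isCliqueUnion_single : single.IsCliqueUnion := fun _ _ _ h => h.elim

/-- The copy of the vertex `x` of `G` in `G.duplicate v`. -/
def oldVert (G : LabelledGraph) (v x : G.Vert) : (G.duplicate v).Vert := x.castSucc

/-- The vertex added by the duplication of `v`. -/
def newVert (G : LabelledGraph) (v : G.Vert) : (G.duplicate v).Vert := Fin.last (G.last + 1)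

/-- The copy of the vertex `x` of `G` in `G.isolate v`. -/
def keptVert (G : LabelledGraph) (v x : G.Vert) : (G.isolate v).Vert := x

@[simp] lemma oldVert_inj {G : LabelledGraph} {v x y : G.Vert} :
    G.oldVert v x = G.oldVert v y ↔ x = y := (Fin.castSucc_injective _).eq_iff

@[simp] lemma oldVert_ne_newVert {G : LabelledGraph} {v x : G.Vert} :
    G.oldVert v x ≠ G.newVert v := Fin.castSucc_ne_last x

@[simp] lemma newVert_ne_oldVert {G : LabelledGraph} {v x : G.Vert} :
    G.newVert v ≠ G.oldVert v x := (Fin.castSucc_ne_last x).symm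

lemma eq_newVert_or_oldVert {G : LabelledGraph} {v : G.Vert} (y : (G.duplicate v).Vert) :
    y = G.newVert v ∨ ∃ x, y = G.oldVert v x := by
  rcases Fin.eq_castSucc_or_eq_last (n := G.last + 1) y with ⟨x, hx⟩ | h
  · exact .inr ⟨x, hx⟩
  · exact .inl h

lemma sum_duplicate {G : LabelledGraph} {v : G.Vert} (f : (G.duplicate v).Vert → ℕ) :
    ∑ y, f y = ∑ x, f (G.oldVert v x) + f (G.newVert v) :=
  Fin.sum_univ_castSucc (n := G.last + 1) f

lemma sum_isolate {G : LabelledGraph} {v : G.Vert} (f : (G.isolate v).Vert → ℕ) :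
    ∑ y, f y = ∑ x, f (G.keptVert v x) := rfl

lemma duplicate_adj_old_old {G : LabelledGraph} {v x y : G.Vert} :
    (G.duplicate v).graph.Adj (G.oldVert v x) (G.oldVert v y) ↔ G.graph.Adj x y := by
  refine (or_congr (SimpleGraph.map_adj _ _ _ _) (SimpleGraph.fromRel_adj _ _ _)).trans ?_
  constructor
  · rintro (⟨a, b, hab, ha, hb⟩ | ⟨-, ⟨h, -⟩ | ⟨h, -⟩⟩)
    · rwa [← Fin.castSucc_injective _ ha, ← Fin.castSucc_injective _ hb]
    · exact absurd h oldVert_ne_newVert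
    · exact absurd h oldVert_ne_newVert
  · exact fun h => .inl ⟨x, y, h, rfl, rfl⟩

lemma duplicate_adj_old_new {G : LabelledGraph} {v x : G.Vert} :
    (G.duplicate v).graph.Adj (G.oldVert v x) (G.newVert v) ↔ x = v ∨ G.graph.Adj v x := by
  refine (or_congr (SimpleGraph.map_adj _ _ _ _) (SimpleGraph.fromRel_adj _ _ _)).trans ?_
  constructor
  · rintro (⟨a, b, hab, ha, hb⟩ | ⟨-, ⟨h, -⟩ | ⟨-, u, hu, h⟩⟩)
    · exact absurd hb (Fin.castSucc_ne_last b)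
    · exact absurd h oldVert_ne_newVert
    · rwa [Fin.castSucc_injective _ hu]
  · exact fun h => .inr ⟨oldVert_ne_newVert, .inr ⟨rfl, x, rfl, h⟩⟩

lemma duplicate_adj_new_old {G : LabelledGraph} {v x : G.Vert} :
    (G.duplicate v).graph.Adj (G.newVert v) (G.oldVert v x) ↔ x = v ∨ G.graph.Adj v x := by
  rw [SimpleGraph.adj_comm, duplicate_adj_old_new]

lemma isolate_adj {G : LabelledGraph} {v x y : G.Vert} :
    (G.isolate v).graph.Adj (G.keptVert v x) (G.keptVert v y) ↔
      G.graph.Adj x y ∧ x ≠ v ∧ y ≠ v :=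
  SimpleGraph.deleteIncidenceSet_adj

lemma keptVert_inj {G : LabelledGraph} {v x y : G.Vert} :
    G.keptVert v x = G.keptVert v y ↔ x = y := Iff.rfl

lemma IsCliqueUnion.duplicate {G : LabelledGraph} (h : G.IsCliqueUnion) (v : G.Vert) :
    (G.duplicate v).IsCliqueUnion := by
  have key : ∀ a b : G.Vert, (a = v ∨ G.graph.Adj v a) → (b = v ∨ G.graph.Adj v b) → a ≠ b →
      G.graph.Adj a b := by
    rintro a b (rfl | ha) (rfl | hb) hab
    · exact absurd rfl hab
    · exact hb
    · exact ha.symm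
    · exact h ha.symm hb hab
  have key' : ∀ a b : G.Vert, G.graph.Adj a b → (b = v ∨ G.graph.Adj v b) →
      (a = v ∨ G.graph.Adj v a) := by
    rintro a b hab (rfl | hb)
    · exact .inr hab.symm
    · by_cases hav : a = v
      · exact .inl hav
      · exact .inr (h hb hab.symm (Ne.symm hav))
  intro x y z
  rcases eq_newVert_or_oldVert x with rfl | ⟨a, rfl⟩ <;>
    rcases eq_newVert_or_oldVert y with rfl | ⟨b, rfl⟩ <;>
    rcases eq_newVert_or_oldVert z with rfl | ⟨c, rfl⟩
  · exact fun h1 => absurd rfl h1.ne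
  · exact fun h1 => absurd rfl h1.ne
  · exact fun _ _ h1 => absurd rfl h1
  · rw [duplicate_adj_new_old, duplicate_adj_old_old, duplicate_adj_new_old]
    exact fun h1 h2 _ => key' c b h2.symm h1
  · exact fun _ h1 => absurd rfl h1.ne
  · rw [duplicate_adj_old_new, duplicate_adj_new_old, duplicate_adj_old_old]
    exact fun h1 h2 h3 => key a c h1 h2 fun hac => h3 (congrArg _ hac)
  · rw [duplicate_adj_old_new, duplicate_adj_old_new, duplicate_adj_old_old]
    exact fun h1 h2 _ => key' a b h1 h2
  · simp only [duplicate_adj_old_old]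
    exact fun h1 h2 h3 => h h1 h2 fun hac => h3 (congrArg _ hac)

lemma IsCliqueUnion.isolate {G : LabelledGraph} (h : G.IsCliqueUnion) (v : G.Vert) :
    (G.isolate v).IsCliqueUnion := by
  intro x y z h1 h2 h3
  have h1' := (isolate_adj (G := G) (x := x) (y := y)).1 h1
  have h2' := (isolate_adj (G := G) (x := y) (y := z)).1 h2
  exact (isolate_adj (G := G) (x := x) (y := z)).2 ⟨h h1'.1 h2'.1 h3, h1'.2.1, h2'.2.2⟩

open Classical in
/-- The number of vertices in the closed neighbourhood of `x`; in a disjoint union of cliques,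
the size of the clique of `x`. -/
noncomputable def cliqueSize (G : LabelledGraph) (x : G.Vert) : ℕ :=
  (Finset.univ.filter fun y => y = x ∨ G.graph.Adj x y).card

open Classical in
lemma degree_add_one (G : LabelledGraph) (x : G.Vert) :
    G.graph.degree x + 1 = G.cliqueSize x := by
  have : (Finset.univ.filter fun y => y = x ∨ G.graph.Adj x y)
      = insert x (G.graph.neighborFinset x) := by
    ext y; simp
  rw [cliqueSize, this, Finset.card_insert_of_notMem (by simp),
    SimpleGraph.card_neighborFinset_eq_degree]

open Classical in
lemma numInCliques_eq (G : LabelledGraph) (k : ℕ) :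
    G.numInCliques k = ∑ x : G.Vert, if G.cliqueSize x = k then 1 else 0 := by
  rw [numInCliques, Finset.card_filter]
  exact Finset.sum_congr rfl fun x _ => by simp only [← degree_add_one]

@[simp] lemma numInCliques_zero (G : LabelledGraph) : G.numInCliques 0 = 0 := by
  simp [numInCliques]

lemma numInCliques_le (G : LabelledGraph) (k : ℕ) : G.numInCliques k ≤ G.numVerts :=
  Finset.card_le_univ _

open Classical in
lemma cliqueSize_oldVert (G : LabelledGraph) (v x : G.Vert) :
    (G.duplicate v).cliqueSize (G.oldVert v x) =
      G.cliqueSize x + if x = v ∨ G.graph.Adj v x then 1 else 0 := by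
  simp only [cliqueSize, Finset.card_filter]
  rw [sum_duplicate]
  simp only [duplicate_adj_old_old, duplicate_adj_old_new, oldVert_inj, newVert_ne_oldVert,
    false_or]

lemma cliqueSize_newVert (G : LabelledGraph) (v : G.Vert) :
    (G.duplicate v).cliqueSize (G.newVert v) = G.cliqueSize v + 1 := by
  classical
  simp only [cliqueSize, Finset.card_filter]
  rw [sum_duplicate]
  simp only [duplicate_adj_new_old, oldVert_ne_newVert, false_or, true_or, if_true]

lemma cliqueSize_keptVert_self (G : LabelledGraph) (v : G.Vert) :
    (G.isolate v).cliqueSize (G.keptVert v v) = 1 := by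
  classical
  simp only [cliqueSize, Finset.card_filter]
  rw [sum_isolate]
  simp [isolate_adj, keptVert_inj]

open Classical in
lemma cliqueSize_keptVert_of_ne (G : LabelledGraph) {v x : G.Vert} (hx : x ≠ v) :
    (G.isolate v).cliqueSize (G.keptVert v x) + (if G.graph.Adj v x then 1 else 0) =
      G.cliqueSize x := by
  have h1 : (if G.graph.Adj v x then 1 else 0) =
      ∑ y : G.Vert, if y = v then (if G.graph.Adj v x then 1 else 0) else 0 := by
    rw [Finset.sum_ite_eq' Finset.univ v, if_pos (Finset.mem_univ _)]
  simp only [cliqueSize, Finset.card_filter]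
  rw [sum_isolate, h1, ← Finset.sum_add_distrib]
  refine Finset.sum_congr rfl fun y _ => ?_
  simp only [isolate_adj, keptVert_inj]
  by_cases hy : y = v
  · subst hy
    simp [G.graph.adj_comm x, hx.symm]
  · simp [hy, hx]

/-- In a disjoint union of cliques, adjacent vertices have the same clique size. -/
lemma IsCliqueUnion.cliqueSize_eq {G : LabelledGraph} (h : G.IsCliqueUnion) {x v : G.Vert}
    (hx : x = v ∨ G.graph.Adj v x) : G.cliqueSize x = G.cliqueSize v := by
  classical
  rcases hx with rfl | hx
  · rfl
  unfold cliqueSize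
  congr 1
  ext y
  simp only [Finset.mem_filter, Finset.mem_univ, true_and]
  constructor
  · rintro (rfl | hy)
    · exact .inr hx
    · by_cases hyv : y = v
      · exact .inl hyv
      · exact .inr (h hx hy (Ne.symm hyv))
  · rintro (rfl | hy)
    · exact .inr hx.symm
    · by_cases hyx : y = x
      · exact .inl hyx
      · exact .inr (h hx.symm hy (Ne.symm hyx))

open Classical in
lemma sum_closedNbhd (G : LabelledGraph) (x : G.Vert) :
    ∑ v : G.Vert, (if x = v ∨ G.graph.Adj v x then 1 else 0) = G.cliqueSize x := by
  rw [cliqueSize, Finset.card_filter]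
  exact Finset.sum_congr rfl fun v _ => by
    simp only [G.graph.adj_comm x v, eq_comm (a := v) (b := x)]

open Classical in
lemma sum_adj_add_one (G : LabelledGraph) (x : G.Vert) :
    ∑ v : G.Vert, (if G.graph.Adj v x then 1 else 0) + 1 = G.cliqueSize x := by
  rw [← sum_closedNbhd]
  have : ∑ v : G.Vert, (if x = v then 1 else 0) = 1 := by simp
  refine (congrArg (_ + ·) this.symm).trans ?_
  rw [← Finset.sum_add_distrib]
  refine Finset.sum_congr rfl fun v _ => ?_
  by_cases h : x = v
  · subst h; simp
  · simp [h]

open Classical in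
lemma numInCliques_duplicate (G : LabelledGraph) (v : G.Vert) (k : ℕ) :
    (G.duplicate v).numInCliques k =
      ∑ x : G.Vert, (if G.cliqueSize x + (if x = v ∨ G.graph.Adj v x then 1 else 0) = k
        then 1 else 0) + if G.cliqueSize v + 1 = k then 1 else 0 := by
  rw [numInCliques_eq, sum_duplicate]
  simp only [cliqueSize_oldVert, cliqueSize_newVert]

open Classical in
lemma numInCliques_isolate (G : LabelledGraph) (v : G.Vert) (k : ℕ) :
    (G.isolate v).numInCliques k =
      ∑ x : G.Vert, (if (G.isolate v).cliqueSize (G.keptVert v x) = k then 1 else 0) := by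
  rw [numInCliques_eq, sum_isolate]

/-- Double counting of the pairs of a vertex `v` to be duplicated and a vertex that has degree
`k - 1` afterwards. -/
lemma sum_numInCliques_duplicate (G : LabelledGraph) {k : ℕ} (hk : 1 ≤ k) :
    ∑ v : G.Vert, (G.duplicate v).numInCliques k + k * G.numInCliques k =
      G.numVerts * G.numInCliques k + k * G.numInCliques (k - 1) := by
  classical
  have hx : ∀ x : G.Vert,
      ∑ v : G.Vert, (if G.cliqueSize x + (if x = v ∨ G.graph.Adj v x then 1 else 0) = k
        then 1 else 0) + k * (if G.cliqueSize x = k then 1 else 0) =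
      G.numVerts * (if G.cliqueSize x = k then 1 else 0) +
        (k - 1) * (if G.cliqueSize x = k - 1 then 1 else 0) := by
    intro x
    have h1 : k * (if G.cliqueSize x = k then 1 else 0) =
        ∑ v : G.Vert, (if x = v ∨ G.graph.Adj v x then 1 else 0) *
          (if G.cliqueSize x = k then 1 else 0) := by
      rw [← Finset.sum_mul, sum_closedNbhd]
      split_ifs with h <;> simp [h]
    have h2 : (k - 1) * (if G.cliqueSize x = k - 1 then 1 else 0) =
        ∑ v : G.Vert, (if x = v ∨ G.graph.Adj v x then 1 else 0) *
          (if G.cliqueSize x = k - 1 then 1 else 0) := by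
      rw [← Finset.sum_mul, sum_closedNbhd]
      split_ifs with h <;> simp [h]
    have h3 : G.numVerts * (if G.cliqueSize x = k then 1 else 0) =
        ∑ v : G.Vert, (if G.cliqueSize x = k then 1 else 0) := by
      rw [Finset.sum_const, smul_eq_mul]; rfl
    rw [h1, h2, h3, ← Finset.sum_add_distrib, ← Finset.sum_add_distrib]
    -- The closed neighbourhood of `x` grows, by one vertex, exactly if it contains `v`.
    refine Finset.sum_congr rfl fun v _ => ?_
    by_cases h : x = v ∨ G.graph.Adj v x
    · simp only [h, if_true]
      split_ifs <;> omega
    · simp [h]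
  have hsum := Finset.sum_congr (rfl : (Finset.univ : Finset G.Vert) = Finset.univ)
    fun x _ => hx x
  simp only [Finset.sum_add_distrib, ← Finset.mul_sum] at hsum
  rw [Finset.sum_comm] at hsum
  simp only [← numInCliques_eq] at hsum
  have hnew : ∑ v : G.Vert, (if G.cliqueSize v + 1 = k then 1 else 0) =
      G.numInCliques (k - 1) := by
    rw [numInCliques_eq]
    exact Finset.sum_congr rfl fun v _ => by congr 1; exact propext (by omega)
  simp only [numInCliques_duplicate, Finset.sum_add_distrib, hnew]
  obtain ⟨j, rfl⟩ : ∃ j, k = j + 1 := ⟨k - 1, by omega⟩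
  rw [Nat.add_sub_cancel] at hsum ⊢
  linarith

/-- Double counting of the pairs of a vertex `v` to be isolated and a vertex that has degree
`k - 1` afterwards. -/
lemma sum_numInCliques_isolate (G : LabelledGraph) (k : ℕ) :
    ∑ v : G.Vert, (G.isolate v).numInCliques k + k * G.numInCliques k =
      G.numVerts * G.numInCliques k + G.numVerts * (if k = 1 then 1 else 0) +
        k * G.numInCliques (k + 1) := by
  classical
  have hx : ∀ x : G.Vert,
      ∑ v : G.Vert, (if (G.isolate v).cliqueSize (G.keptVert v x) = k then 1 else 0) +
        k * (if G.cliqueSize x = k then 1 else 0) =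
      G.numVerts * (if G.cliqueSize x = k then 1 else 0) + (if k = 1 then 1 else 0) +
        k * (if G.cliqueSize x = k + 1 then 1 else 0) := by
    intro x
    have h1 : k * (if G.cliqueSize x = k then 1 else 0) =
        ∑ v : G.Vert, (if x = v ∨ G.graph.Adj v x then 1 else 0) *
          (if G.cliqueSize x = k then 1 else 0) := by
      rw [← Finset.sum_mul, sum_closedNbhd]
      split_ifs with h <;> simp [h]
    have h2 : k * (if G.cliqueSize x = k + 1 then 1 else 0) =
        ∑ v : G.Vert, (if G.graph.Adj v x then 1 else 0) *
          (if G.cliqueSize x = k + 1 then 1 else 0) := by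
      rw [← Finset.sum_mul]
      have := sum_adj_add_one G x
      split_ifs with h
      · rw [h] at this
        omega
      · simp
    have h3 : G.numVerts * (if G.cliqueSize x = k then 1 else 0) =
        ∑ v : G.Vert, (if G.cliqueSize x = k then 1 else 0) := by
      rw [Finset.sum_const, smul_eq_mul]; rfl
    have h4 : (if k = 1 then 1 else 0) =
        ∑ v : G.Vert, (if x = v then (if k = 1 then 1 else 0) else 0) := by
      rw [Finset.sum_ite_eq Finset.univ x, if_pos (Finset.mem_univ _)]
    rw [h1, h2, h3, h4, ← Finset.sum_add_distrib, ← Finset.sum_add_distrib,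
      ← Finset.sum_add_distrib]
    -- For `v = x` one vertex is left; otherwise the neighbourhood of `x` loses `v` if it
    -- contains `v`.
    refine Finset.sum_congr rfl fun v _ => ?_
    by_cases h : x = v
    · subst h
      simp [cliqueSize_keptVert_self, eq_comm, add_comm]
    · have := cliqueSize_keptVert_of_ne G h
      by_cases h' : G.graph.Adj v x
      · simp only [h, h', or_true, if_true, if_false] at this ⊢
        split_ifs <;> omega
      · simp only [h, h', or_false, if_false] at this ⊢
        split_ifs <;> omega
  have hsum := Finset.sum_congr (rfl : (Finset.univ : Finset G.Vert) = Finset.univ)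
    fun x _ => hx x
  simp only [Finset.sum_add_distrib, ← Finset.mul_sum] at hsum
  rw [Finset.sum_comm] at hsum
  simp only [← numInCliques_eq, Finset.sum_const, smul_eq_mul] at hsum
  simp only [numInCliques_isolate]
  exact hsum

open Classical in
/-- The size of the closed neighbourhood of `v`, replaced by zero if it exceeds `n`, is at most `n`.
In this form the bound can be compared vertex by vertex with the change of `numInCliques`. -/
lemma sum_closedNbhd_mul_le (G : LabelledGraph) (v : G.Vert) (n : ℕ) :
    ∑ x : G.Vert, (if x = v ∨ G.graph.Adj v x then 1 else 0) *
      (if G.cliqueSize v ≤ n then 1 else 0) ≤ n := by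
  rw [← Finset.sum_mul, ← Finset.card_filter]
  change G.cliqueSize v * _ ≤ n
  split_ifs with h <;> simp [h]

/-- In a disjoint union of cliques the duplication of `v` matters for the vertices of degree
`k - 1` only if the clique of `v` has at most `k` vertices. -/
lemma IsCliqueUnion.abs_numInCliques_duplicate_sub_le {G : LabelledGraph} (hG : G.IsCliqueUnion)
    (v : G.Vert) (k : ℕ) :
    |((G.duplicate v).numInCliques k : ℝ) - G.numInCliques k| ≤ k + 2 := by
  classical
  have hle := sum_closedNbhd_mul_le G v k
  have h1 : (G.duplicate v).numInCliques k ≤ G.numInCliques k + (k + 1) := by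
    rw [numInCliques_duplicate, numInCliques_eq, ← add_assoc]
    refine add_le_add ?_ (by split_ifs <;> simp)
    refine le_trans ?_ (Nat.add_le_add_left hle _)
    rw [← Finset.sum_add_distrib]
    refine Finset.sum_le_sum fun x _ => ?_
    by_cases h : x = v ∨ G.graph.Adj v x
    · have := hG.cliqueSize_eq h
      simp only [h, if_true]
      split_ifs <;> omega
    · simp [h]
  have h2 : G.numInCliques k ≤ (G.duplicate v).numInCliques k + k := by
    have : G.numInCliques k ≤ ∑ x : G.Vert,
        (if G.cliqueSize x + (if x = v ∨ G.graph.Adj v x then 1 else 0) = k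
        then 1 else 0) + k := by
      rw [numInCliques_eq]
      refine le_trans ?_ (Nat.add_le_add_left hle _)
      rw [← Finset.sum_add_distrib]
      refine Finset.sum_le_sum fun x _ => ?_
      by_cases h : x = v ∨ G.graph.Adj v x
      · have := hG.cliqueSize_eq h
        simp only [h, if_true]
        split_ifs <;> omega
      · simp [h]
    rw [numInCliques_duplicate]
    omega
  have h1' : ((G.duplicate v).numInCliques k : ℝ) ≤ G.numInCliques k + (k + 1) := by
    exact_mod_cast h1
  have h2' : (G.numInCliques k : ℝ) ≤ (G.duplicate v).numInCliques k + k := by exact_mod_cast h2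
  rw [abs_le]
  constructor <;> linarith

/-- In a disjoint union of cliques the isolation of `v` matters for the vertices of degree `k - 1`
other than `v` only if the clique of `v` has at most `k + 1` vertices. -/
lemma IsCliqueUnion.abs_numInCliques_isolate_sub_le {G : LabelledGraph} (hG : G.IsCliqueUnion)
    (v : G.Vert) (k : ℕ) :
    |((G.isolate v).numInCliques k : ℝ) - G.numInCliques k| ≤ k + 2 := by
  classical
  have hle := sum_closedNbhd_mul_le G v (k + 1)
  have hv : ∑ x : G.Vert, (if x = v then 1 else 0) = 1 := by simp
  have h1 : (G.isolate v).numInCliques k ≤ G.numInCliques k + (k + 1 + 1) := by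
    rw [numInCliques_isolate, numInCliques_eq]
    refine le_trans ?_ (Nat.add_le_add_left (Nat.add_le_add hle hv.le) _)
    rw [← Finset.sum_add_distrib, ← Finset.sum_add_distrib]
    refine Finset.sum_le_sum fun x _ => ?_
    by_cases h : x = v
    · simp only [h, if_true]
      split_ifs <;> omega
    · have := cliqueSize_keptVert_of_ne G h
      by_cases h' : G.graph.Adj v x
      · have hs := hG.cliqueSize_eq (.inr h')
        simp only [h, h', or_true, if_true, if_false] at this ⊢
        split_ifs <;> omega
      · simp only [h, h', or_false, if_false] at this ⊢
        split_ifs <;> omega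
  have h2 : G.numInCliques k ≤ (G.isolate v).numInCliques k + (k + 1 + 1) := by
    rw [numInCliques_isolate, numInCliques_eq]
    refine le_trans ?_ (Nat.add_le_add_left (Nat.add_le_add hle hv.le) _)
    rw [← Finset.sum_add_distrib, ← Finset.sum_add_distrib]
    refine Finset.sum_le_sum fun x _ => ?_
    by_cases h : x = v
    · simp only [h, if_true]
      split_ifs <;> omega
    · have := cliqueSize_keptVert_of_ne G h
      by_cases h' : G.graph.Adj v x
      · have hs := hG.cliqueSize_eq (.inr h')
        simp only [h, h', or_true, if_true, if_false] at this ⊢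
        split_ifs <;> omega
      · simp only [h, h', or_false, if_false] at this ⊢
        split_ifs <;> omega
  have h1' : ((G.isolate v).numInCliques k : ℝ) ≤ G.numInCliques k + (k + 1 + 1) := by
    exact_mod_cast h1
  have h2' : (G.numInCliques k : ℝ) ≤ (G.isolate v).numInCliques k + (k + 1 + 1) := by
    exact_mod_cast h2
  rw [abs_le]
  constructor <;> linarith

@[simp] lemma numVerts_duplicate (G : LabelledGraph) (v : G.Vert) :
    (G.duplicate v).numVerts = G.numVerts + 1 := by
  simp [numVerts_eq, duplicate]

@[simp] lemma numVerts_isolate (G : LabelledGraph) (v : G.Vert) :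
    (G.isolate v).numVerts = G.numVerts := by
  simp [numVerts_eq, isolate]

end LabelledGraph

/-! ### Averages of martingale differences -/

section Martingale

variable {Ω : Type*} {mΩ : MeasurableSpace Ω} {μ : Measure Ω}
  {ℱ : Filtration ℕ mΩ} {ξ : ℕ → Ω → ℝ} {C : ℝ}

lemma ae_abs_sum_le (hbd : ∀ m, ∀ᵐ ω ∂μ, |ξ m ω| ≤ C) :
    ∀ᵐ ω ∂μ, ∀ m n : ℕ, |∑ i ∈ Finset.Ico m n, ξ i ω| ≤ (n - m : ℕ) * C := by
  filter_upwards [ae_all_iff.2 hbd] with ω h m n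
  calc |∑ i ∈ Finset.Ico m n, ξ i ω| ≤ ∑ i ∈ Finset.Ico m n, |ξ i ω| :=
        Finset.abs_sum_le_sum_abs _ _
    _ ≤ ∑ _i ∈ Finset.Ico m n, C := Finset.sum_le_sum fun i _ => h i
    _ = (n - m : ℕ) * C := by simp

lemma measurable_sum_martingaleDifference (hm : ∀ m, Measurable[ℱ (m + 1)] (ξ m)) (m : ℕ) :
    Measurable[ℱ m] fun ω => ∑ i ∈ Finset.range m, ξ i ω :=
  Finset.measurable_fun_sum _ fun i hi =>
    (hm i).mono (ℱ.mono (Finset.mem_range.1 hi)) le_rfl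

/-- Martingale differences are orthogonal to the past. -/
lemma integral_sq_sum_le [IsProbabilityMeasure μ]
    (hm : ∀ m, Measurable[ℱ (m + 1)] (ξ m))
    (hbd : ∀ m, ∀ᵐ ω ∂μ, |ξ m ω| ≤ C) (hce : ∀ m, μ[ξ m | ℱ m] =ᵐ[μ] 0) (m : ℕ) :
    Integrable (fun ω => (∑ i ∈ Finset.range m, ξ i ω) ^ 2) μ ∧
      ∫ ω, (∑ i ∈ Finset.range m, ξ i ω) ^ 2 ∂μ ≤ m * C ^ 2 := by
  have hξm : ∀ m, AEStronglyMeasurable (ξ m) μ := fun m =>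
    ((hm m).mono (ℱ.le _) le_rfl).aestronglyMeasurable
  have hξi : ∀ m, Integrable (ξ m) μ := fun m => Integrable.of_bound (hξm m) C (hbd m)
  have hξ2 : ∀ m, ∀ᵐ ω ∂μ, ‖ξ m ω ^ 2‖ ≤ C ^ 2 := fun m => by
    filter_upwards [hbd m] with ω h
    rw [norm_pow]
    exact pow_le_pow_left₀ (norm_nonneg _) h 2
  have hξi2 : ∀ m, Integrable (fun ω => ξ m ω ^ 2) μ := fun m =>
    Integrable.of_bound ((hξm m).pow 2) _ (hξ2 m)
  induction m with
  | zero => simp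
  | succ m ih =>
    obtain ⟨ih1, ih2⟩ := ih
    set S : Ω → ℝ := fun ω => ∑ i ∈ Finset.range m, ξ i ω with hS
    have hSm : Measurable[ℱ m] S := measurable_sum_martingaleDifference hm m
    have hSb : ∀ᵐ ω ∂μ, ‖S ω‖ ≤ m * C := by
      filter_upwards [ae_abs_sum_le hbd] with ω h
      simpa using h 0 m
    have hprod : Integrable (S * ξ m) μ :=
      (hξi m).bdd_mul (hSm.mono (ℱ.le _) le_rfl).aestronglyMeasurable hSb
    have horth : ∫ ω, (S * ξ m) ω ∂μ = 0 := by
      rw [← integral_condExp (ℱ.le m)]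
      have h1 := condExp_mul_of_stronglyMeasurable_left (μ := μ) hSm.stronglyMeasurable hprod
        (hξi m)
      have h2 : μ[S * ξ m | ℱ m] =ᵐ[μ] 0 := by
        filter_upwards [h1, hce m] with ω h1 h2
        rw [h1, Pi.mul_apply, h2]
        simp
      rw [integral_congr_ae h2]
      simp
    have hexp : (fun ω => (∑ i ∈ Finset.range (m + 1), ξ i ω) ^ 2) =
        fun ω => (S ω ^ 2 + 2 * (S * ξ m) ω) + ξ m ω ^ 2 := by
      funext ω
      rw [Finset.sum_range_succ, Pi.mul_apply]
      simp only [hS]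
      ring
    rw [hexp]
    refine ⟨(ih1.add (hprod.const_mul 2)).add (hξi2 m), ?_⟩
    have hint : ∫ ω, (S ω ^ 2 + 2 * (S * ξ m) ω) + ξ m ω ^ 2 ∂μ =
        (∫ ω, S ω ^ 2 ∂μ + 2 * ∫ ω, (S * ξ m) ω ∂μ) + ∫ ω, ξ m ω ^ 2 ∂μ := by
      rw [← integral_const_mul, ← integral_add ih1 (hprod.const_mul 2)]
      exact integral_add (ih1.add (hprod.const_mul 2)) (hξi2 m)
    rw [hint, horth]
    have h3 : ∫ ω, ξ m ω ^ 2 ∂μ ≤ C ^ 2 := by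
      have := norm_integral_le_of_norm_le_const (hξ2 m)
      simp only [probReal_univ, mul_one] at this
      exact (le_abs_self _).trans this
    push_cast
    linarith

/-- The strong law of large numbers for bounded martingale differences. Along the squares the second
moments of the averages are summable, and between consecutive squares the partial sums vary little
because the differences are bounded. -/
lemma ae_tendsto_average_martingaleDifference [IsProbabilityMeasure μ]
    (hm : ∀ m, Measurable[ℱ (m + 1)] (ξ m))
    (hbd : ∀ m, ∀ᵐ ω ∂μ, |ξ m ω| ≤ C) (hce : ∀ m, μ[ξ m | ℱ m] =ᵐ[μ] 0) :
    ∀ᵐ ω ∂μ, Tendsto (fun m : ℕ => (∑ i ∈ Finset.range m, ξ i ω) / m) atTop (𝓝 0) := by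
  set X : ℕ → Ω → ℝ := fun j ω => (∑ i ∈ Finset.range (j ^ 2), ξ i ω) / (j ^ 2 : ℕ) with hX
  have hXm : ∀ j, Measurable (X j) := fun j =>
    ((measurable_sum_martingaleDifference hm (j ^ 2)).mono (ℱ.le _) le_rfl).div_const _
  have hlin : ∀ j, ∫⁻ ω, ENNReal.ofReal (X j ω ^ 2) ∂μ ≤
      ENNReal.ofReal (C ^ 2 * (1 / (j : ℝ) ^ 2)) := by
    intro j
    obtain ⟨h1, h2⟩ := integral_sq_sum_le hm hbd hce (j ^ 2)
    have hXe : (fun ω => X j ω ^ 2) =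
        fun ω => (∑ i ∈ Finset.range (j ^ 2), ξ i ω) ^ 2 / ((j ^ 2 : ℕ) : ℝ) ^ 2 := by
      funext ω; simp only [hX, div_pow]
    rw [← ofReal_integral_eq_lintegral_ofReal (by rw [hXe]; exact h1.div_const _)
      (ae_of_all _ fun ω => sq_nonneg _)]
    refine ENNReal.ofReal_le_ofReal ?_
    rw [hXe, integral_div]
    rcases Nat.eq_zero_or_pos j with rfl | hj
    · simp
    · have hj' : (0 : ℝ) < j := by exact_mod_cast hj
      rw [div_le_iff₀ (by positivity)]
      refine h2.trans_eq ?_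
      push_cast
      field_simp
  have hsum : ∑' j, ∫⁻ ω, ENNReal.ofReal (X j ω ^ 2) ∂μ ≠ ⊤ := by
    have hs : Summable fun j : ℕ => C ^ 2 * (1 / (j : ℝ) ^ 2) :=
      (Real.summable_one_div_nat_pow.2 one_lt_two).mul_left _
    refine ne_top_of_le_ne_top ?_ (ENNReal.tsum_le_tsum hlin)
    rw [← ENNReal.ofReal_tsum_of_nonneg (fun j => by positivity) hs]
    exact ENNReal.ofReal_ne_top
  rw [← lintegral_tsum fun j => ((hXm j).pow_const 2).ennreal_ofReal.aemeasurable] at hsum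
  have hfin := ae_lt_top'
    (AEMeasurable.tsum fun j => ((hXm j).pow_const 2).ennreal_ofReal.aemeasurable) hsum
  filter_upwards [hfin, ae_abs_sum_le hbd] with ω hω hdiff
  have hsq : Tendsto (fun j => X j ω) atTop (𝓝 0) := by
    have h1 := ENNReal.tendsto_atTop_zero_of_tsum_ne_top hω.ne
    have h2 := (ENNReal.tendsto_toReal ENNReal.zero_ne_top).comp h1
    have h3 : Tendsto (fun j => X j ω ^ 2) atTop (𝓝 0) := by
      refine h2.congr fun j => ?_
      simp [ENNReal.toReal_ofReal, sq_nonneg]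
    have h4 := h3.sqrt
    simp only [Real.sqrt_sq_eq_abs, Real.sqrt_zero] at h4
    exact (tendsto_zero_iff_abs_tendsto_zero _).2 h4
  have hC : 0 ≤ C := by
    have := (abs_nonneg _).trans (hdiff 0 1)
    simpa using this
  have hsqrt : Tendsto Nat.sqrt atTop atTop :=
    tendsto_atTop.2 fun b => (eventually_ge_atTop (b * b)).mono fun m hm => Nat.le_sqrt.2 hm
  have hlim : Tendsto (fun m : ℕ => |X m.sqrt ω| + 2 * C / m.sqrt) atTop (𝓝 0) := by
    have h1 := (hsq.comp hsqrt).abs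
    have h2 : Tendsto (fun m : ℕ => 2 * C / (m.sqrt : ℝ)) atTop (𝓝 0) :=
      (tendsto_natCast_atTop_atTop.comp hsqrt).const_div_atTop _
    simpa using h1.add h2
  refine squeeze_zero_norm' ?_ hlim
  filter_upwards [eventually_ge_atTop 1] with m hm1
  set j := m.sqrt with hj
  have hj1 : 1 ≤ j := Nat.le_sqrt.2 (by simpa using hm1)
  have hjm : j ^ 2 ≤ m := Nat.sqrt_le' m
  have hmj : m - j ^ 2 ≤ 2 * j := by
    have := Nat.sqrt_le_add m
    rw [← hj] at this
    rw [sq]; omega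
  have hj0 : (0 : ℝ) < j := by exact_mod_cast hj1
  have hm0 : (0 : ℝ) < m := by exact_mod_cast hm1
  have hjm' : (j : ℝ) ^ 2 ≤ m := by exact_mod_cast hjm
  have h1 := hdiff (j ^ 2) m
  have h2 : ((m - j ^ 2 : ℕ) : ℝ) * C ≤ 2 * j * C :=
    mul_le_mul_of_nonneg_right (by exact_mod_cast hmj) hC
  rw [Real.norm_eq_abs, ← Finset.sum_range_add_sum_Ico _ hjm, abs_div, abs_of_pos hm0]
  calc |∑ i ∈ Finset.range (j ^ 2), ξ i ω + ∑ i ∈ Finset.Ico (j ^ 2) m, ξ i ω| / m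
      ≤ (|∑ i ∈ Finset.range (j ^ 2), ξ i ω| + 2 * j * C) / m := by
        gcongr
        exact (abs_add_le _ _).trans (by gcongr; exact h1.trans h2)
    _ ≤ (|∑ i ∈ Finset.range (j ^ 2), ξ i ω| + 2 * j * C) / (j : ℝ) ^ 2 := by gcongr
    _ = |X j ω| + 2 * C / j := by
        simp only [hX, abs_div, Nat.abs_cast]
        push_cast
        field_simp

end Martingale

/-! ### Transitions of the process -/

namespace LabelledGraph

lemma finite_setOf_last_le (n : ℕ) : {H : LabelledGraph | H.last ≤ n}.Finite := by
  have : {H : LabelledGraph | H.last ≤ n} ⊆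
      ⋃ l ∈ Set.Iic n, Set.range fun g : SimpleGraph (Fin (l + 1)) => (⟨l, g⟩ : LabelledGraph) := by
    rintro ⟨l, g⟩ h
    simp only [Set.mem_iUnion]
    exact ⟨l, h, g, rfl⟩
  exact ((Set.finite_Iic n).biUnion fun l _ => Set.finite_range _).subset this

instance : Countable LabelledGraph := by
  rw [← Set.countable_univ_iff]
  have : (Set.univ : Set LabelledGraph) = ⋃ n, {H : LabelledGraph | H.last ≤ n} := by
    ext H
    simpa using ⟨H.last, le_rfl⟩
  rw [this]
  exact Set.countable_iUnion fun n => (finite_setOf_last_le n).countable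

/-- `H` arises from `G` by one duplication or deletion. -/
def IsStep (G H : LabelledGraph) : Prop := ∃ v : G.Vert, H = G.duplicate v ∨ H = G.isolate v

/-- The mean of `f` after one random step from `G`. -/
noncomputable def stepMean (p : ℝ) (f : LabelledGraph → ℝ) (G : LabelledGraph) : ℝ :=
  p * ∑ v : G.Vert, (1 / (G.numVerts : ℝ)) * f (G.duplicate v) +
    (1 - p) * ∑ v : G.Vert, (1 / (G.numVerts : ℝ)) * f (G.isolate v)

lemma stepProb_eq_zero {p : ℝ} {G H : LabelledGraph} (h : ¬ G.IsStep H) : stepProb p G H = 0 := by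
  have h1 : ∀ v, G.duplicate v ≠ H := fun v hv => h ⟨v, .inl hv.symm⟩
  have h2 : ∀ v, G.isolate v ≠ H := fun v hv => h ⟨v, .inr hv.symm⟩
  simp [stepProb, h1, h2]

lemma sum_stepProb_mul (p : ℝ) (f : LabelledGraph → ℝ) {G : LabelledGraph}
    {S : Finset LabelledGraph} (hS : ∀ H, G.IsStep H → H ∈ S) :
    ∑ H ∈ S, f H * stepProb p G H = stepMean p f G := by
  classical
  have key : ∀ g : G.Vert → LabelledGraph, (∀ v, g v ∈ S) →
      ∑ H ∈ S, f H * ∑ v : G.Vert, (1 / (G.numVerts : ℝ)) * (if g v = H then 1 else 0) =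
        ∑ v : G.Vert, (1 / (G.numVerts : ℝ)) * f (g v) := by
    intro g hg
    simp only [Finset.mul_sum]
    rw [Finset.sum_comm]
    refine Finset.sum_congr rfl fun v _ => ?_
    rw [Finset.sum_eq_single (g v) (fun H _ hH => by simp [hH.symm]) (fun h => absurd (hg v) h)]
    simp [mul_comm]
  rw [stepMean, ← key _ fun v => hS _ ⟨v, .inl rfl⟩, ← key _ fun v => hS _ ⟨v, .inr rfl⟩,
    Finset.mul_sum, Finset.mul_sum, ← Finset.sum_add_distrib]
  refine Finset.sum_congr rfl fun H _ => ?_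
  simp only [stepProb]
  ring

lemma IsStep.isCliqueUnion {G H : LabelledGraph} (h : G.IsStep H) (hG : G.IsCliqueUnion) :
    H.IsCliqueUnion := by
  obtain ⟨v, rfl | rfl⟩ := h
  exacts [hG.duplicate v, hG.isolate v]

lemma IsStep.last_le {G H : LabelledGraph} (h : G.IsStep H) : H.last ≤ G.last + 1 := by
  obtain ⟨v, rfl | rfl⟩ := h
  exacts [le_rfl, Nat.le_succ _]

lemma sum_mean_const (G : LabelledGraph) (c : ℝ) :
    ∑ _v : G.Vert, (1 / (G.numVerts : ℝ)) * c = c := by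
  have : (G.numVerts : ℝ) ≠ 0 := G.numVerts_pos.ne'
  rw [Finset.sum_const, nsmul_eq_mul]
  change (G.numVerts : ℝ) * _ = c
  field_simp

lemma abs_stepMean_sub_le {p : ℝ} (hp0 : 0 < p) (hp1 : p < 1) {f : LabelledGraph → ℝ}
    {G : LabelledGraph} {C : ℝ} (h : ∀ H, G.IsStep H → |f H - f G| ≤ C) :
    |stepMean p f G - f G| ≤ C := by
  have key : ∀ g : G.Vert → LabelledGraph, (∀ v, G.IsStep (g v)) →
      |∑ v : G.Vert, (1 / (G.numVerts : ℝ)) * f (g v) - f G| ≤ C := by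
    intro g hg
    rw [← sum_mean_const G (f G), ← Finset.sum_sub_distrib, ← sum_mean_const G C]
    refine (Finset.abs_sum_le_sum_abs _ _).trans (Finset.sum_le_sum fun v _ => ?_)
    rw [← mul_sub, abs_mul, abs_of_nonneg (by positivity)]
    exact mul_le_mul_of_nonneg_left (h _ (hg v)) (by positivity)
  have h1 := abs_le.1 (key _ fun v => ⟨v, .inl rfl⟩)
  have h2 := abs_le.1 (key _ fun v => ⟨v, .inr rfl⟩)
  have hq := sub_pos.2 hp1
  rw [stepMean, abs_le]
  constructor <;> nlinarith

end LabelledGraph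

namespace IsDuplicationDeletionProcess

open LabelledGraph

variable {Ω : Type*} {mΩ : MeasurableSpace Ω} {p : ℝ} {μ : Measure Ω}
  {ℱ : Filtration ℕ mΩ} {G : ℕ → Ω → LabelledGraph}

lemma measurable (hG : IsDuplicationDeletionProcess p μ ℱ G) (m : ℕ) : Measurable (G m) :=
  (hG.adapted m).mono (ℱ.le m) le_rfl

lemma ae_isStep [IsProbabilityMeasure μ] (hG : IsDuplicationDeletionProcess p μ ℱ G) :
    ∀ᵐ ω ∂μ, ∀ m, (G m ω).IsStep (G (m + 1) ω) := by
  -- There are countably many pairs of graphs, so each impossible transition can be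
  -- excluded separately.
  have key : ∀ (m : ℕ) (A H : LabelledGraph), ¬ A.IsStep H →
      ∀ᵐ ω ∂μ, ¬ (G m ω = A ∧ G (m + 1) ω = H) := by
    intro m A H hAH
    have hA : MeasurableSet[ℱ m] (G m ⁻¹' {A}) := hG.adapted m trivial
    have hA' : MeasurableSet (G m ⁻¹' {A}) := ℱ.le m _ hA
    have hH : MeasurableSet (G (m + 1) ⁻¹' {H}) := hG.measurable (m + 1) trivial
    have h1 := setIntegral_condExp (μ := μ) (ℱ.le m)
      ((integrable_const (1 : ℝ)).indicator hH) hA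
    have h2 : ∫ ω in G m ⁻¹' {A},
        (μ[(G (m + 1) ⁻¹' {H}).indicator (fun _ => (1 : ℝ)) | ℱ m]) ω ∂μ = 0 := by
      have : ∫ ω in G m ⁻¹' {A},
          (μ[(G (m + 1) ⁻¹' {H}).indicator (fun _ => (1 : ℝ)) | ℱ m]) ω ∂μ =
          ∫ ω in G m ⁻¹' {A}, (0 : ℝ) ∂μ := by
        refine setIntegral_congr_ae hA' ?_
        filter_upwards [hG.step m H] with ω hω hωA
        rw [hω, show G m ω = A from hωA, stepProb_eq_zero hAH]
      rw [this]; simp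
    rw [h2, setIntegral_indicator hH, setIntegral_const, smul_eq_mul, mul_one] at h1
    have h3 : μ (G m ⁻¹' {A} ∩ G (m + 1) ⁻¹' {H}) = 0 :=
      (measureReal_eq_zero_iff).1 h1.symm
    exact measure_mono_null (fun ω hω => not_not.1 hω) h3
  rw [ae_all_iff]
  intro m
  have := ae_all_iff.2 fun A => ae_all_iff.2 fun H => ae_all_iff.2 fun h => key m A H h
  filter_upwards [this] with ω hω
  by_contra hcon
  exact hω _ _ hcon ⟨rfl, rfl⟩

lemma ae_isCliqueUnion [IsProbabilityMeasure μ] (hG : IsDuplicationDeletionProcess p μ ℱ G) :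
    ∀ᵐ ω ∂μ, ∀ m, (G m ω).IsCliqueUnion := by
  filter_upwards [hG.start, hG.ae_isStep] with ω h0 hs m
  induction m with
  | zero => rw [h0]; exact isCliqueUnion_single
  | succ m ih => exact (hs m).isCliqueUnion ih

lemma ae_last_le [IsProbabilityMeasure μ] (hG : IsDuplicationDeletionProcess p μ ℱ G) :
    ∀ᵐ ω ∂μ, ∀ m, (G m ω).last ≤ m := by
  filter_upwards [hG.start, hG.ae_isStep] with ω h0 hs m
  induction m with
  | zero => rw [h0]; exact le_rfl
  | succ m ih => exact (hs m).last_le.trans (by omega)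

/-- The graph at time `m + 1` takes finitely many values, so every function of it is a finite linear
combination of indicators. -/
lemma condExp_comp [IsProbabilityMeasure μ]
    (hG : IsDuplicationDeletionProcess p μ ℱ G) (f : LabelledGraph → ℝ) (m : ℕ) :
    Integrable (fun ω => f (G (m + 1) ω)) μ ∧
      μ[fun ω => f (G (m + 1) ω) | ℱ m] =ᵐ[μ] fun ω => stepMean p f (G m ω) := by
  classical
  set S := (finite_setOf_last_le (m + 1)).toFinset with hS
  set φ : LabelledGraph → Ω → ℝ := fun H =>
    (f H) • (G (m + 1) ⁻¹' {H}).indicator (fun _ => (1 : ℝ)) with hφ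
  have hφi : ∀ H, Integrable (φ H) μ := fun H =>
    ((integrable_const (1 : ℝ)).indicator (hG.measurable (m + 1) trivial)).smul (f H)
  have hfφ : (fun ω => f (G (m + 1) ω)) =ᵐ[μ] ∑ H ∈ S, φ H := by
    filter_upwards [hG.ae_last_le] with ω hω
    rw [Finset.sum_apply, Finset.sum_eq_single (G (m + 1) ω)]
    · simp [hφ]
    · intro H _ hH
      simp [hφ, Set.indicator, hH.symm]
    · intro h
      exact absurd ((Set.Finite.mem_toFinset (finite_setOf_last_le (m + 1))).2 (hω (m + 1))) h
  refine ⟨(integrable_finsetSum' S fun H _ => hφi H).congr hfφ.symm, ?_⟩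
  refine (condExp_congr_ae hfφ).trans ((condExp_finsetSum (fun H _ => hφi H) _).trans ?_)
  have h1 : ∀ᵐ ω ∂μ, ∀ H, (μ[φ H | ℱ m]) ω = f H * stepProb p (G m ω) H := by
    refine ae_all_iff.2 fun H => ?_
    filter_upwards [condExp_smul (μ := μ) (f H)
      ((G (m + 1) ⁻¹' {H}).indicator (fun _ => (1 : ℝ))) (ℱ m), hG.step m H] with ω h1 h2
    rw [h1, Pi.smul_apply, h2, smul_eq_mul]
  filter_upwards [h1, hG.ae_last_le] with ω h1 h2
  rw [Finset.sum_apply]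
  simp only [h1]
  exact sum_stepProb_mul p f fun H hH =>
    (Set.Finite.mem_toFinset _).2 (hH.last_le.trans (Nat.succ_le_succ (h2 m)))

/-- The noise of a functional with bounded increments averages out. -/
lemma ae_tendsto_noise_average [IsProbabilityMeasure μ] (hp0 : 0 < p) (hp1 : p < 1)
    (hG : IsDuplicationDeletionProcess p μ ℱ G) (f : LabelledGraph → ℝ) (C : ℝ)
    (hf : ∀ A H : LabelledGraph, A.IsCliqueUnion → A.IsStep H → |f H - f A| ≤ C) :
    ∀ᵐ ω ∂μ, Tendsto (fun m : ℕ =>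
      (∑ i ∈ Finset.range m, (f (G (i + 1) ω) - stepMean p f (G i ω))) / m) atTop (𝓝 0) := by
  have hms : ∀ m, Measurable[ℱ m] fun ω => stepMean p f (G m ω) := fun m =>
    (measurable_from_top (f := stepMean p f)).comp (hG.adapted m)
  have hint : ∀ m, Integrable (fun ω => stepMean p f (G m ω)) μ := fun m =>
    integrable_condExp.congr (hG.condExp_comp f m).2
  refine ae_tendsto_average_martingaleDifference (μ := μ) (ℱ := ℱ) (C := C + C)
    (ξ := fun m ω => f (G (m + 1) ω) - stepMean p f (G m ω)) ?_ ?_ ?_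
  · intro m
    exact ((measurable_from_top (f := f)).comp (hG.adapted (m + 1))).sub
      ((hms m).mono (ℱ.mono m.le_succ) le_rfl)
  · intro m
    filter_upwards [hG.ae_isCliqueUnion, hG.ae_isStep] with ω h1 h2
    have e1 := hf _ _ (h1 m) (h2 m)
    have e2 := abs_stepMean_sub_le hp0 hp1 fun H hH => hf _ H (h1 m) hH
    calc |f (G (m + 1) ω) - stepMean p f (G m ω)|
        = |(f (G (m + 1) ω) - f (G m ω)) - (stepMean p f (G m ω) - f (G m ω))| := by ring_nf
      _ ≤ C + C := (abs_sub _ _).trans (add_le_add e1 e2)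
  · intro m
    obtain ⟨h1, h2⟩ := hG.condExp_comp f m
    have h3 := condExp_sub h1 (hint m) (ℱ m)
    have h4 := condExp_of_stronglyMeasurable (μ := μ) (ℱ.le m) (hms m).stronglyMeasurable (hint m)
    refine h3.trans ?_
    rw [h4]
    filter_upwards [h2] with ω h2
    simp [h2]

end IsDuplicationDeletionProcess

/-! ### Deviations from the limit -/

namespace LabelledGraph

lemma stepMean_numVerts (p : ℝ) (G : LabelledGraph) :
    stepMean p (fun H => (H.numVerts : ℝ)) G = G.numVerts + p := by
  simp only [stepMean, numVerts_duplicate, numVerts_isolate, sum_mean_const]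
  push_cast
  ring

lemma stepMean_sub_const_mul (p : ℝ) (f g : LabelledGraph → ℝ) (c : ℝ) (G : LabelledGraph) :
    stepMean p (fun H => f H - c * g H) G = stepMean p f G - c * stepMean p g G := by
  simp only [stepMean, mul_sub, Finset.sum_sub_distrib, mul_left_comm _ c, ← Finset.mul_sum]
  ring

lemma stepMean_numInCliques (p : ℝ) (G : LabelledGraph) {k : ℕ} (hk : 1 ≤ k) :
    stepMean p (fun H => (H.numInCliques k : ℝ)) G = G.numInCliques k +
      k * (p * G.numInCliques (k - 1) + (1 - p) * G.numInCliques (k + 1) - G.numInCliques k) /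
        G.numVerts + (1 - p) * if k = 1 then 1 else 0 := by
  have h1 : (∑ v : G.Vert, ((G.duplicate v).numInCliques k : ℝ)) + k * G.numInCliques k =
      G.numVerts * G.numInCliques k + k * G.numInCliques (k - 1) := by
    exact_mod_cast sum_numInCliques_duplicate G hk
  have h2 : (∑ v : G.Vert, ((G.isolate v).numInCliques k : ℝ)) + k * G.numInCliques k =
      G.numVerts * G.numInCliques k + G.numVerts * (if k = 1 then 1 else 0) +
        k * G.numInCliques (k + 1) := by
    exact_mod_cast sum_numInCliques_isolate G k
  have hN := G.numVerts_pos.ne'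
  rw [stepMean, ← Finset.mul_sum, ← Finset.mul_sum, eq_sub_of_add_eq h1, eq_sub_of_add_eq h2]
  field_simp
  ring

/-- The deviation of the proportion of vertices of degree `k - 1` from its limit, set to zero
for `k = 0`. -/
noncomputable def deviation (d : ℕ → ℝ) (k : ℕ) (G : LabelledGraph) : ℝ :=
  if k = 0 then 0 else (G.numInCliques k : ℝ) / G.numVerts - d k

/-- The number of vertices of degree `k - 1` minus the number `d k * N` predicted by the limiting
proportion. -/
noncomputable def excess (d : ℕ → ℝ) (k : ℕ) (G : LabelledGraph) : ℝ :=
  G.numInCliques k - d k * G.numVerts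

lemma deviation_mul_numVerts (d : ℕ → ℝ) {k : ℕ} (hk : 1 ≤ k) (G : LabelledGraph) :
    deviation d k G * G.numVerts = excess d k G := by
  have hN := G.numVerts_pos.ne'
  rw [deviation, if_neg (by omega), excess]
  field_simp

lemma abs_deviation_le {d : ℕ → ℝ} {B : ℝ} (hB : ∀ k, |d k| ≤ B) (k : ℕ) (G : LabelledGraph) :
    |deviation d k G| ≤ 1 + B := by
  have hB0 : 0 ≤ B := (abs_nonneg _).trans (hB 0)
  unfold deviation
  split_ifs
  · rw [abs_zero]; linarith
  · refine (abs_sub _ _).trans (add_le_add ?_ (hB k))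
    rw [abs_of_nonneg (by positivity), div_le_one G.numVerts_pos]
    exact_mod_cast G.numInCliques_le k

/-- For `k = 1` the isolated vertex created by a deletion plays the role of the boundary value
`d 0 = (1 - p) / p`. -/
lemma stepMean_excess {p : ℝ} (hp0 : 0 < p) {d : ℕ → ℝ} (hd : IsBoundedPositiveSolution p d)
    {k : ℕ} (hk : 1 ≤ k) (G : LabelledGraph) :
    stepMean p (excess d k) G = excess d k G +
      k * (p * deviation d (k - 1) G + (1 - p) * deviation d (k + 1) G - deviation d k G) := by
  have hN := G.numVerts_pos.ne'
  have hrec := hd.mul_eq hp0 hk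
  have h : stepMean p (excess d k) G = _ := stepMean_sub_const_mul p
    (fun H => (H.numInCliques k : ℝ)) (fun H => (H.numVerts : ℝ)) (d k) G
  rw [h, stepMean_numVerts, stepMean_numInCliques p G hk]
  obtain ⟨j, rfl⟩ : ∃ j, k = j + 1 := ⟨k - 1, by omega⟩
  rw [Nat.add_sub_cancel] at hrec ⊢
  rcases Nat.eq_zero_or_pos j with rfl | hj
  · have h0 : p * d 0 = 1 - p := by rw [hd.zero]; field_simp
    rw [h0] at hrec
    simp only [deviation, excess, numInCliques_zero]
    norm_num at hrec ⊢
    have : d 1 * p = (1 - p + (1 - p) * d 2) - d 1 := by linarith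
    rw [mul_add, this]
    field_simp
    ring
  · have hj1 : ¬ j + 1 = 1 := by omega
    simp only [deviation, excess, if_neg hj1, if_neg hj.ne', if_neg (Nat.succ_ne_zero _)]
    have : d (j + 1) * p = ((j + 1 : ℕ) : ℝ) * (p * d j + (1 - p) * d (j + 1 + 1)) -
      ((j + 1 : ℕ) : ℝ) * d (j + 1) := by linarith
    rw [mul_add, this]
    field_simp
    ring

lemma abs_excess_sub_le (d : ℕ → ℝ) (k : ℕ) {A H : LabelledGraph} (hA : A.IsCliqueUnion)
    (h : A.IsStep H) : |excess d k H - excess d k A| ≤ k + 2 + |d k| := by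
  obtain ⟨v, rfl | rfl⟩ := h
  · have h1 := hA.abs_numInCliques_duplicate_sub_le v k
    calc |excess d k (A.duplicate v) - excess d k A|
        = |(((A.duplicate v).numInCliques k : ℝ) - A.numInCliques k) - d k| := by
          simp only [excess, numVerts_duplicate]; push_cast; ring_nf
      _ ≤ k + 2 + |d k| := (abs_sub _ _).trans (by gcongr)
  · have h1 := hA.abs_numInCliques_isolate_sub_le v k
    calc |excess d k (A.isolate v) - excess d k A|
        = |((A.isolate v).numInCliques k : ℝ) - A.numInCliques k| := by
          simp only [excess, numVerts_isolate]; ring_nf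
      _ ≤ k + 2 + |d k| := by linarith [abs_nonneg (d k)]

end LabelledGraph

namespace IsDuplicationDeletionProcess

open LabelledGraph

variable {Ω : Type*} {mΩ : MeasurableSpace Ω} {p : ℝ} {μ : Measure Ω} [IsProbabilityMeasure μ]
  {ℱ : Filtration ℕ mΩ} {G : ℕ → Ω → LabelledGraph}

lemma ae_tendsto_numVerts_div (hp0 : 0 < p) (hp1 : p < 1)
    (hG : IsDuplicationDeletionProcess p μ ℱ G) :
    ∀ᵐ ω ∂μ, Tendsto (fun m : ℕ => ((G m ω).numVerts : ℝ) / m) atTop (𝓝 p) := by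
  have h := hG.ae_tendsto_noise_average hp0 hp1 (fun H => (H.numVerts : ℝ)) 1 (by
    rintro A H - ⟨v, rfl | rfl⟩ <;> simp)
  filter_upwards [h] with ω hω
  have h0 : Tendsto (fun m : ℕ => ((G 0 ω).numVerts : ℝ) / m) atTop (𝓝 0) :=
    tendsto_const_div_atTop_nhds_zero_nat _
  have h1 := (hω.add h0).add_const p
  rw [add_zero, zero_add] at h1
  refine h1.congr' ?_
  filter_upwards [eventually_ge_atTop 1] with m hm
  have hm0 : (m : ℝ) ≠ 0 := by positivity
  have hsum : ∑ i ∈ Finset.range m,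
      (((G (i + 1) ω).numVerts : ℝ) - stepMean p (fun H => (H.numVerts : ℝ)) (G i ω)) =
      (G m ω).numVerts - (G 0 ω).numVerts - m * p := by
    simp only [stepMean_numVerts, ← sub_sub]
    rw [Finset.sum_sub_distrib, Finset.sum_range_sub fun i => ((G i ω).numVerts : ℝ)]
    simp
  rw [hsum]
  field_simp
  ring

end IsDuplicationDeletionProcess

theorem mainTheorem1 (p : ℝ) (hp0 : 0 < p) (hp1 : p < 1) :
    (∃! d : ℕ → ℝ, IsBoundedPositiveSolution p d) ∧
    ∀ d : ℕ → ℝ, IsBoundedPositiveSolution p d →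
      ∀ (Ω : Type*) (mΩ : MeasurableSpace Ω) (μ : Measure Ω) (_ : IsProbabilityMeasure μ)
        (ℱ : Filtration ℕ mΩ) (G : ℕ → Ω → LabelledGraph),
        IsDuplicationDeletionProcess p μ ℱ G →
          ∀ k : ℕ, 1 ≤ k → ∀ᵐ ω ∂μ,
            Tendsto (fun m : ℕ => ((G m ω).numInCliques k : ℝ) / ((G m ω).numVerts : ℝ))
              atTop (𝓝 (d k)) := by
  constructor
  · obtain ⟨d, hd⟩ := exists_isBoundedPositiveSolution hp0 hp1
    exact ⟨d, hd, fun e he => he.unique hp0 hp1 hd⟩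
  · intro d hd Ω mΩ μ _ ℱ G hG k hk
    obtain ⟨B, hB⟩ := hd.bounded
    have hnoise := ae_all_iff.2 fun j => hG.ae_tendsto_noise_average hp0 hp1
      (LabelledGraph.excess d j) (j + 2 + |d j|)
      fun A H hA h => LabelledGraph.abs_excess_sub_le d j hA h
    filter_upwards [hnoise, hG.ae_tendsto_numVerts_div hp0 hp1] with ω hω hNω
    have hlim := tendsto_zero_of_deviation_recursion hp0 hp1
      (y := fun j m => LabelledGraph.deviation d j (G m ω))
      (N := fun m => ((G m ω).numVerts : ℝ)) (B := 1 + B)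
      (ζ := fun j m => LabelledGraph.excess d j (G (m + 1) ω) -
        LabelledGraph.stepMean p (LabelledGraph.excess d j) (G m ω))
      (fun m => (G m ω).numVerts_pos) hNω (fun m => if_pos rfl)
      (fun j m => LabelledGraph.abs_deviation_le hB j _)
      (fun j m hj => by
        rw [LabelledGraph.deviation_mul_numVerts d hj, LabelledGraph.deviation_mul_numVerts d hj,
          LabelledGraph.stepMean_excess hp0 hd hj]
        ring) (fun j _ => hω j) k
    have h := hlim.add_const (d k)
    rw [zero_add] at h
    refine h.congr fun m => ?_
    rw [LabelledGraph.deviation, if_neg (by omega), sub_add_cancel]
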